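/- For $f\in\mathcal S(\mathbb R)$ (the complex-valued Schwartz functions on $\mathbb R$) put $\widehat f(\xi)=\int_{\mathbb R} f(x)\,e^{2\pi i x\xi}\,dx$. Let $0<\alpha<1$, $0<\beta<1$ and $f\in\mathcal S(\mathbb R)$. (A) If $f(\pm\log(n+1))=0$ and $\widehat f(\pm n^{\alpha})=0$ for every integer $n\ge 0$, then $f\equiv 0$. (B) Let $$A=\Big\{(\alpha,\beta)\in[0,1]^2 :\ \alpha+\beta<1,\ \text{ and either } \alpha<1-\frac{\beta}{1-\alpha-\beta}\ \text{ or }\ \beta<1-\frac{\alpha}{1-\alpha-\beta}\Big\}.$$ If $(\alpha,\beta)\in A$, and $f(\pm n^{\alpha})=0$ and $\widehat f(\pm n^{\beta})=0$ for every integer $n\ge 0$, then $f\equiv 0$. -/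

import Mathlib

open scoped SchwartzMap

/-- The Fourier transform of `f : ℝ → ℂ`, normalised as
`f̂(ξ) = ∫ f(x) e^{2πi x ξ} dx` (note the plus sign in the exponent). -/
noncomputable def fourierHat (f : ℝ → ℂ) (ξ : ℝ) : ℂ :=
  ∫ x : ℝ, f x * Complex.exp (2 * (Real.pi : ℂ) * Complex.I * (x : ℂ) * (ξ : ℂ))

/-- The region `A` of admissible pairs of exponents `(α, β)` in the unit square. -/
def admissibleRegion : Set (ℝ × ℝ) :=
  {p | p.1 ∈ Set.Icc (0 : ℝ) 1 ∧ p.2 ∈ Set.Icc (0 : ℝ) 1 ∧ p.1 + p.2 < 1 ∧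
    (p.1 < 1 - p.2 / (1 - p.1 - p.2) ∨ p.2 < 1 - p.1 / (1 - p.1 - p.2))}

/-! Write g for the (inverse) Fourier transform of f. If f has j zeros within Cj/|x|^a of x, the
Lagrange error formula bounds f(x) by sup|f^(j)| (Cj/|x|^a)^j / j!, and sup|f^(j)| is bounded by a
weighted sup of g of order j+2. As j^j/j! ≤ e^j, decay of g of order j+2 gives decay of f of order
aj at geometric cost (`weighted_bound_of_denseZeros`); likewise from f to g with gain b.

When ab > 1 the round trip gains, so the weighted sups of g and f grow only geometrically in their
order, which forces bounded support (`exists_forall_eq_zero_of_weighted_bounds`). A function and its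
transform cannot both have bounded support unless they vanish (`eq_zero_of_bounded_supports`).

The points n^α have spacing exponent 1/α - 1; those of log n beat every power. For two powers, ab >
1 means α + β < 1. -/

/-! ### Interpolation error at the zeros of a function. -/

/-- Iterated Rolle: a smooth function with `n + 1` zeros has a zero of its `n`-th derivative. -/
lemma exists_iteratedDeriv_eq_zero_of_strictMono (n : ℕ) :
    ∀ {f : ℝ → ℝ}, ContDiff ℝ n f → ∀ u : Fin (n + 1) → ℝ, StrictMono u → (∀ i, f (u i) = 0) →
      ∃ y, iteratedDeriv n f y = 0 := by
  induction n with
  | zero => intro f _ u _ h0; exact ⟨u 0, by simpa using h0 0⟩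
  | succ n ih =>
    intro f hf u hu h0
    have key : ∀ i : Fin (n + 1), ∃ c ∈ Set.Ioo (u i.castSucc) (u i.succ), deriv f c = 0 := fun i =>
      exists_deriv_eq_zero (hu i.castSucc_lt_succ) hf.continuous.continuousOn (by rw [h0, h0])
    choose v hv hv0 using key
    have hmono : StrictMono v := Fin.strictMono_iff_lt_succ.2 fun i => by
      have h1 := (hv i.castSucc).2
      have h2 := (hv i.succ).1
      rw [Fin.succ_castSucc] at h1
      exact h1.trans h2
    have hd : ContDiff ℝ n (deriv f) := by
      have : ContDiff ℝ ((n : WithTop ℕ∞) + 1) f := by exact_mod_cast hf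
      exact (contDiff_succ_iff_deriv.1 this).2.2
    obtain ⟨y, hy⟩ := ih hd v hmono hv0
    exact ⟨y, by rwa [iteratedDeriv_succ']⟩

lemma exists_iteratedDeriv_eq_zero_of_finset {f : ℝ → ℝ} {n : ℕ} (hf : ContDiff ℝ n f)
    (S : Finset ℝ) (hS : S.card = n + 1) (h0 : ∀ s ∈ S, f s = 0) :
    ∃ y, iteratedDeriv n f y = 0 :=
  exists_iteratedDeriv_eq_zero_of_strictMono n hf (S.orderEmbOfFin hS)
    (S.orderEmbOfFin hS).strictMono fun i => h0 _ (S.orderEmbOfFin_mem hS i)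

lemma iteratedDeriv_polynomial_eval (p : Polynomial ℝ) (n : ℕ) :
    iteratedDeriv n (fun x => p.eval x) = fun x => ((Polynomial.derivative^[n]) p).eval x := by
  induction n with
  | zero => simp
  | succ n ih =>
    rw [iteratedDeriv_succ, ih, Function.iterate_succ_apply']
    ext x
    exact Polynomial.deriv _

lemma Polynomial.Monic.iterate_derivative_natDegree {p : Polynomial ℝ} (hp : p.Monic) :
    (Polynomial.derivative^[p.natDegree]) p = Polynomial.C (p.natDegree.factorial : ℝ) := by
  have h : ((Polynomial.derivative^[p.natDegree]) p).natDegree = 0 := by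
    have := Polynomial.natDegree_iterate_derivative p p.natDegree
    omega
  rw [Polynomial.eq_C_of_natDegree_eq_zero h, Polynomial.coeff_iterate_derivative]
  simp [Nat.descFactorial_self, hp.coeff_natDegree]

/-- Error bound for Lagrange interpolation of the zero function. -/
lemma abs_le_of_zeros {f : ℝ → ℝ} (S : Finset ℝ) (hf : ContDiff ℝ S.card f)
    (h0 : ∀ s ∈ S, f s = 0) {M : ℝ} (hM : ∀ y, |iteratedDeriv S.card f y| ≤ M) (x : ℝ) :
    |f x| ≤ M / S.card.factorial * ∏ s ∈ S, |x - s| := by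
  have hM0 : 0 ≤ M := (abs_nonneg _).trans (hM 0)
  by_cases hx : x ∈ S
  · rw [h0 x hx, abs_zero]
    positivity
  set p : Polynomial ℝ := Lagrange.nodal S id with hp
  have hpx : p.eval x = ∏ s ∈ S, (x - s) := by simp [hp, Lagrange.eval_nodal]
  have hpx0 : p.eval x ≠ 0 := by
    rw [hpx]
    exact Finset.prod_ne_zero_iff.2 fun s hs h => hx (by rwa [sub_eq_zero.1 h])
  -- This K makes f - K p vanish at x too, giving the extra zero Rolle needs.
  set K : ℝ := f x / p.eval x with hK
  have hpS : ContDiff ℝ S.card (fun y => K * p.eval y) := 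
    contDiff_const.mul (by simpa using p.contDiff_aeval (𝕜 := ℝ) S.card)
  have hcard : (insert x S).card = S.card + 1 := Finset.card_insert_of_notMem hx
  obtain ⟨y, hy⟩ := exists_iteratedDeriv_eq_zero_of_finset (hf.sub hpS) (insert x S) hcard (by
    intro s hs
    rcases Finset.mem_insert.1 hs with rfl | hs
    · simp [hK, div_mul_cancel₀ _ hpx0]
    · have : p.eval s = 0 := Lagrange.eval_nodal_at_node (v := id) hs
      simp [h0 s hs, this])
  have hdeg : p.natDegree = S.card := Lagrange.natDegree_nodal
  have hmon : p.Monic := Lagrange.nodal_monic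
  have hder := hmon.iterate_derivative_natDegree
  rw [hdeg] at hder
  have hpd : iteratedDeriv S.card (fun y => K * p.eval y) y = K * S.card.factorial := by
    rw [iteratedDeriv_const_mul_field, iteratedDeriv_polynomial_eval]
    simp [hder]
  have hy' : iteratedDeriv S.card f y = K * S.card.factorial := by
    rw [iteratedDeriv_fun_sub hf.contDiffAt hpS.contDiffAt, hpd] at hy
    linarith
  have hfac : (0 : ℝ) < S.card.factorial := by positivity
  have hKM : |K| ≤ M / S.card.factorial := by
    rw [le_div_iff₀ hfac, ← abs_of_pos hfac, ← abs_mul, ← hy']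
    exact hM y
  have hfx : f x = K * p.eval x := by rw [hK, div_mul_cancel₀ _ hpx0]
  rw [hfx, abs_mul, hpx, Finset.abs_prod]
  gcongr

/-- Rolle fails for complex values, so the real and imaginary parts are bounded separately; hence
the factor 2. -/
lemma norm_le_of_zeros {f : ℝ → ℂ} (S : Finset ℝ) (hf : ContDiff ℝ S.card f)
    (h0 : ∀ s ∈ S, f s = 0) {M : ℝ} (hM : ∀ y, ‖iteratedDeriv S.card f y‖ ≤ M) (x : ℝ) :
    ‖f x‖ ≤ 2 * (M / S.card.factorial * ∏ s ∈ S, |x - s|) := by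
  have comp : ∀ L : ℂ →L[ℝ] ℝ, (∀ z, |L z| ≤ ‖z‖) →
      |L (f x)| ≤ M / S.card.factorial * ∏ s ∈ S, |x - s| := by
    intro L hL
    refine abs_le_of_zeros (f := fun y => L (f y)) S (L.contDiff.comp hf)
      (fun s hs => by simp [h0 s hs]) (fun y => ?_) x
    have : iteratedDeriv S.card (fun y => L (f y)) y = L (iteratedDeriv S.card f y) := by
      have := L.iteratedFDeriv_comp_left (f := f) (x := y) hf.contDiffAt (i := S.card) le_rfl
      rw [iteratedDeriv_eq_iteratedFDeriv, iteratedDeriv_eq_iteratedFDeriv]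
      exact congrArg (fun m => m fun _ => 1) this
    rw [this]
    exact (hL _).trans (hM y)
  have h1 := comp Complex.reCLM Complex.abs_re_le_norm
  have h2 := comp Complex.imCLM Complex.abs_im_le_norm
  calc ‖f x‖ ≤ |(f x).re| + |(f x).im| := Complex.norm_le_abs_re_add_abs_im _
    _ ≤ _ := by
      simp only [Complex.reCLM_apply, Complex.imCLM_apply] at h1 h2
      linarith
-- Derivatives of a Fourier transform.
-- The two extra powers of the weight pay for the integrable factor 1/(1 + y²), whose integral is π.
open scoped FourierTransform in
lemma norm_iteratedDeriv_fourier_le (g : 𝓢(ℝ, ℂ)) (j : ℕ) {M : ℝ}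
    (h : ∀ ξ : ℝ, max 1 |ξ| ^ (j + 2) * ‖g ξ‖ ≤ M) (x : ℝ) :
    ‖iteratedDeriv j (𝓕 (g : ℝ → ℂ)) x‖ ≤ (2 * Real.pi) ^ (j + 1) * M := by
  have hint : ∀ n : ℕ, MeasureTheory.Integrable fun x : ℝ => x ^ n • g x := fun n => by
    have := g.integrable_pow_mul MeasureTheory.volume n
    refine this.mono' (by fun_prop) (Filter.Eventually.of_forall fun x => ?_)
    simp
  rw [Real.iteratedDeriv_fourier (N := ⊤) (fun n _ => hint n) le_top]
  have hbd : ∀ y : ℝ, ‖(-2 * Real.pi * Complex.I * y) ^ j • g y‖ ≤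
      (2 * Real.pi) ^ j * (2 * M) * (1 + y ^ 2)⁻¹ := by
    intro y
    have h1 : (1 : ℝ) ≤ max 1 |y| := le_max_left _ _
    have h2 : |y| ≤ max 1 |y| := le_max_right _ _
    have hw : |y| ^ j * (1 + y ^ 2) ≤ 2 * max 1 |y| ^ (j + 2) := by
      have e1 : |y| ^ j ≤ max 1 |y| ^ j := by gcongr
      have e2 : 1 + y ^ 2 ≤ 2 * max 1 |y| ^ 2 := by
        have := one_le_pow₀ h1 (n := 2)
        have := pow_le_pow_left₀ (abs_nonneg y) h2 2
        rw [sq_abs] at this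
        linarith
      calc |y| ^ j * (1 + y ^ 2) ≤ max 1 |y| ^ j * (2 * max 1 |y| ^ 2) := by gcongr
        _ = _ := by ring
    have hpos : 0 < 1 + y ^ 2 := by positivity
    have hn : ‖(-2 * Real.pi * Complex.I * y : ℂ)‖ = 2 * Real.pi * |y| := by
      simp [abs_of_pos Real.pi_pos]
    rw [norm_smul, norm_pow, hn, ← div_eq_mul_inv, le_div_iff₀ hpos]
    calc (2 * Real.pi * |y|) ^ j * ‖g y‖ * (1 + y ^ 2)
        = (2 * Real.pi) ^ j * (|y| ^ j * (1 + y ^ 2)) * ‖g y‖ := by rw [mul_pow]; ring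
      _ ≤ (2 * Real.pi) ^ j * (2 * max 1 |y| ^ (j + 2)) * ‖g y‖ := by gcongr
      _ = (2 * Real.pi) ^ j * (2 * (max 1 |y| ^ (j + 2) * ‖g y‖)) := by ring
      _ ≤ (2 * Real.pi) ^ j * (2 * M) := by gcongr; exact h y
  calc _ ≤ ∫ y : ℝ, ‖(-2 * Real.pi * Complex.I * y) ^ j • g y‖ :=
        VectorFourier.norm_fourierIntegral_le_integral_norm _ _ _ _ _
    _ ≤ ∫ y : ℝ, (2 * Real.pi) ^ j * (2 * M) * (1 + y ^ 2)⁻¹ :=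
        MeasureTheory.integral_mono_of_nonneg (Filter.Eventually.of_forall fun _ => norm_nonneg _)
          (integrable_inv_one_add_sq.const_mul _) (Filter.Eventually.of_forall hbd)
    _ = _ := by
        rw [MeasureTheory.integral_const_mul, integral_univ_inv_one_add_sq]; ring

/-- Weighted sup bounds on `g` control the derivatives of `f`, as when `f` and `g` are
Fourier transforms of one another. -/
def DerivControl (f g : ℝ → ℂ) : Prop :=
  ∀ (j : ℕ) (M : ℝ), (∀ ξ : ℝ, max 1 |ξ| ^ (j + 2) * ‖g ξ‖ ≤ M) →
    ∀ x : ℝ, ‖iteratedDeriv j f x‖ ≤ (2 * Real.pi) ^ (j + 1) * M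

open scoped FourierTransform in
lemma derivControl_fourier (g : 𝓢(ℝ, ℂ)) : DerivControl (𝓕 g : 𝓢(ℝ, ℂ)) g := by
  intro j M h x
  exact norm_iteratedDeriv_fourier_le g j h x

open scoped FourierTransform in
lemma derivControl_fourierInv (g : 𝓢(ℝ, ℂ)) : DerivControl (𝓕⁻ g : 𝓢(ℝ, ℂ)) g := by
  intro j M h x
  have : ((𝓕⁻ g : 𝓢(ℝ, ℂ)) : ℝ → ℂ) = fun x => 𝓕 (g : ℝ → ℂ) (-x) := by
    ext x
    rw [SchwartzMap.fourierInv_coe, Real.fourierInv_eq_fourier_neg]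
  rw [this, iteratedDeriv_comp_neg, norm_smul]
  simpa using norm_iteratedDeriv_fourier_le g j h (-x)

open scoped FourierTransform in
lemma fourierHat_eq_fourierInv (f : 𝓢(ℝ, ℂ)) (ξ : ℝ) :
    fourierHat f ξ = (𝓕⁻ f : 𝓢(ℝ, ℂ)) ξ := by
  rw [SchwartzMap.fourierInv_coe, Real.fourierInv_eq_fourier_neg,
    Real.fourier_real_eq_integral_exp_smul, fourierHat]
  congr 1
  ext x
  rw [smul_eq_mul, mul_comm]
  congr 2
  push_cast
  ring

/-! ### From dense zeros to decay. -/

/-- The zeros of `f` near `x` have spacing `O(|x| ^ (-a))`. -/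
def DenseZeros (f : ℝ → ℂ) (a C : ℝ) : Prop :=
  ∀ x : ℝ, 1 ≤ |x| → ∀ j : ℕ, ∃ S : Finset ℝ, S.card = j ∧
    ∀ s ∈ S, f s = 0 ∧ |x - s| ≤ C * j / |x| ^ a

open scoped ContDiff in
lemma weighted_bound_of_denseZeros {f g : ℝ → ℂ} {a C : ℝ} (hf : ContDiff ℝ ∞ f) (hC : 0 ≤ C)
    (hfg : DerivControl f g) (hz : DenseZeros f a C) :
    ∃ K : ℝ, 1 ≤ K ∧ ∀ (j : ℕ) (M : ℝ), (∀ ξ : ℝ, max 1 |ξ| ^ (j + 2) * ‖g ξ‖ ≤ M) →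
      ∀ x : ℝ, (max 1 |x| ^ a) ^ j * ‖f x‖ ≤ K ^ (j + 1) * M := by
  have hpi : (1 : ℝ) ≤ 2 * Real.pi := by linarith [Real.pi_gt_three]
  set D : ℝ := max 1 (C * Real.exp 1) with hD
  have hD1 : 1 ≤ D := le_max_left _ _
  have hDC : C * Real.exp 1 ≤ D := le_max_right _ _
  have hK1 : 1 ≤ 2 * (2 * Real.pi * D) := by nlinarith
  refine ⟨2 * (2 * Real.pi * D), hK1, fun j M hM x => ?_⟩
  have hM0 : 0 ≤ M := le_trans (by positivity) (hM 0)
  rcases le_total 1 |x| with hx | hx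
  · obtain ⟨S, hS, hs⟩ := hz x hx j
    rw [max_eq_right hx]
    set ρ : ℝ := |x| ^ a with hρ
    have hρ0 : 0 < ρ := Real.rpow_pos_of_pos (by linarith) _
    have hb := norm_le_of_zeros S (hf.of_le (by exact_mod_cast le_top)) (fun s h => (hs s h).1)
      (M := (2 * Real.pi) ^ (j + 1) * M) (by rw [hS]; exact hfg j M hM) x
    have hprod : ∏ s ∈ S, |x - s| ≤ (C * j / ρ) ^ j := by
      calc ∏ s ∈ S, |x - s| ≤ ∏ _s ∈ S, (C * j / ρ) :=
            Finset.prod_le_prod (fun _ _ => abs_nonneg _) fun s h => (hs s h).2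
        _ = _ := by rw [Finset.prod_const, hS]
    have hfac : (j : ℝ) ^ j / j.factorial ≤ Real.exp 1 ^ j := by
      rw [← Real.exp_nat_mul, mul_one]
      exact Real.pow_div_factorial_le_exp _ (by positivity) j
    rw [hS] at hb
    calc ρ ^ j * ‖f x‖
        ≤ ρ ^ j * (2 * ((2 * Real.pi) ^ (j + 1) * M / j.factorial * (C * j / ρ) ^ j)) := by
          gcongr
          exact hb.trans (by gcongr)
      _ = 2 * (2 * Real.pi) ^ (j + 1) * C ^ j * ((j : ℝ) ^ j / j.factorial) * M := by
          rw [div_pow, mul_pow C]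
          field_simp
      _ ≤ 2 * (2 * Real.pi) ^ (j + 1) * C ^ j * (Real.exp 1 ^ j) * M := by gcongr
      _ = 2 * (2 * Real.pi) ^ (j + 1) * (C * Real.exp 1) ^ j * M := by rw [mul_pow]; ring
      _ ≤ 2 ^ (j + 1) * (2 * Real.pi) ^ (j + 1) * D ^ (j + 1) * M := by
          have h2 : (2 : ℝ) ≤ 2 ^ (j + 1) := le_self_pow₀ (by norm_num) (by omega)
          have h3 : (C * Real.exp 1) ^ j ≤ D ^ (j + 1) :=
            (pow_le_pow_left₀ (by positivity) hDC j).trans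
              (pow_le_pow_right₀ hD1 (Nat.le_succ j))
          gcongr
      _ = _ := by simp only [mul_pow]; ring
  · have h0 := hfg 0 M (fun ξ => le_trans (by gcongr; exacts [le_max_left _ _, by omega]) (hM ξ)) x
    rw [max_eq_left hx, Real.one_rpow, one_pow, one_mul]
    rw [iteratedDeriv_zero, zero_add, pow_one] at h0
    have h1 : 2 * Real.pi ≤ (2 * (2 * Real.pi * D)) ^ (j + 1) := by
      calc 2 * Real.pi ≤ 2 * (2 * Real.pi * D) := by nlinarith
        _ ≤ _ := le_self_pow₀ hK1 (by omega)
    exact h0.trans (by gcongr)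
-- Bootstrapping decay to bounded support.
/-- If weighted bounds transfer from `g` to `f` with gain `a` and back with gain `b`, where
`a * b > 1`, then `g` has bounded support. -/
lemma exists_forall_eq_zero_of_weighted_bounds {f g : ℝ → ℂ} {a b K B : ℝ} (ha : 0 < a)
    (hb : 0 < b) (hab : 1 < a * b) (hK : 1 ≤ K) (hB : 1 ≤ B) (hg : ∀ x, ‖g x‖ ≤ B)
    (hdecay : ∀ n : ℕ, ∃ M, ∀ x, max 1 |x| ^ n * ‖g x‖ ≤ M)
    (hgf : ∀ (j : ℕ) (M : ℝ), (∀ ξ : ℝ, max 1 |ξ| ^ (j + 2) * ‖g ξ‖ ≤ M) →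
      ∀ x : ℝ, (max 1 |x| ^ a) ^ j * ‖f x‖ ≤ K ^ (j + 1) * M)
    (hfg : ∀ (j : ℕ) (M : ℝ), (∀ ξ : ℝ, max 1 |ξ| ^ (j + 2) * ‖f ξ‖ ≤ M) →
      ∀ x : ℝ, (max 1 |x| ^ b) ^ j * ‖g x‖ ≤ K ^ (j + 1) * M) :
    ∃ L : ℝ, 1 ≤ L ∧ ∀ x, L < |x| → g x = 0 := by
  have hw1 : ∀ x : ℝ, 1 ≤ max 1 |x| := fun x => le_max_left _ _
  have hw0 : ∀ x : ℝ, 0 < max 1 |x| := fun x => one_pos.trans_le (hw1 x)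
  have hab0 : 0 < a * b := mul_pos ha hb
  -- The midpoint of 1/(ab) and 1: the slack θb > 1/a absorbs the additive shifts once j ≥ j₀.
  set θ : ℝ := (1 + (a * b)⁻¹) / 2 with hθ
  have hinv : (a * b)⁻¹ < 1 := inv_lt_one_of_one_lt₀ hab
  have hinv0 : 0 < (a * b)⁻¹ := inv_pos.2 hab0
  have hθ1 : θ < 1 := by rw [hθ]; linarith
  have hθ0 : 0 < θ := by rw [hθ]; linarith
  have hθab : a⁻¹ < θ * b := by
    have h : (a * b)⁻¹ * b < θ * b := by
      apply mul_lt_mul_of_pos_right _ hb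
      rw [hθ]; linarith
    rwa [mul_inv, mul_assoc, inv_mul_cancel₀ hb.ne', mul_one] at h
  obtain ⟨j₀, hj₀⟩ := exists_nat_gt ((2 * a⁻¹ + 3) / (θ * b - a⁻¹))
  rw [div_lt_iff₀ (by linarith)] at hj₀
  set Q : ℝ := K ^ ((1 + b) / (1 - θ)) with hQ
  set B' : ℝ := B ^ (1 - θ)⁻¹ with hB'
  have hθ1' : 0 < 1 - θ := by linarith
  have hQ1 : 1 ≤ Q := Real.one_le_rpow hK (by positivity)
  have hB'1 : 1 ≤ B' := Real.one_le_rpow hB (by positivity)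
  have main : ∀ j : ℕ, j₀ ≤ j → ∀ ξ : ℝ, (max 1 |ξ| ^ b) ^ j * ‖g ξ‖ ≤ B' * Q ^ j := by
    intro j hj
    have hjR : (2 * a⁻¹ + 3) ≤ j * (θ * b - a⁻¹) := by
      refine hj₀.le.trans ?_
      have : (j₀ : ℝ) ≤ j := by exact_mod_cast hj
      gcongr
    have hwb : ∀ ξ : ℝ, (max 1 |ξ| ^ b) ^ j = max 1 |ξ| ^ (b * j) := fun ξ => by
      rw [← Real.rpow_natCast, ← Real.rpow_mul (hw0 ξ).le]
    have hbdd : BddAbove (Set.range fun ξ : ℝ => (max 1 |ξ| ^ b) ^ j * ‖g ξ‖) := by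
      obtain ⟨M, hM⟩ := hdecay ⌈b * j⌉₊
      refine ⟨M, ?_⟩
      rintro _ ⟨ξ, rfl⟩
      refine le_trans ?_ (hM ξ)
      dsimp only
      rw [hwb, ← Real.rpow_natCast]
      gcongr
      · exact hw1 ξ
      · exact Nat.le_ceil _
    set M : ℝ := ⨆ ξ : ℝ, (max 1 |ξ| ^ b) ^ j * ‖g ξ‖ with hMdef
    have hM : ∀ ξ : ℝ, (max 1 |ξ| ^ b) ^ j * ‖g ξ‖ ≤ M := fun ξ => le_ciSup hbdd ξ
    suffices hMle : M ≤ B' * Q ^ j from fun ξ => (hM ξ).trans hMle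
    rcases le_or_gt M 1 with hM1 | hM1
    · exact hM1.trans (one_le_mul_of_one_le_of_one_le hB'1 (one_le_pow₀ hQ1))
    have hM0 : 0 < M := one_pos.trans hM1
    -- Least m with am ≥ j + 2, the decay of f needed to return to g at order bj.
    set m : ℕ := ⌈(j + 2) / a⌉₊ with hm
    have hm1 : (j + 2) / a ≤ m := Nat.le_ceil _
    have hm2 : (m : ℝ) < (j + 2) / a + 1 := Nat.ceil_lt_add_one (by positivity)
    have hm3 : (m : ℝ) + 2 ≤ b * j * θ := by
      rw [div_eq_mul_inv] at hm2
      linarith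
    have hm4 : (m : ℝ) + 2 ≤ b * j :=
      hm3.trans (mul_le_of_le_one_right (by positivity) hθ1.le)
    -- Interpolation between order 0 (bounded by B) and order bj (bounded by M).
    have step1 : ∀ ξ : ℝ, max 1 |ξ| ^ (m + 2) * ‖g ξ‖ ≤ B * M ^ θ := by
      intro ξ
      have e1 : max 1 |ξ| ^ (m + 2) ≤ (max 1 |ξ| ^ (b * j)) ^ θ := by
        rw [← Real.rpow_mul (hw0 ξ).le, ← Real.rpow_natCast]
        apply Real.rpow_le_rpow_of_exponent_le (hw1 ξ)
        push_cast
        exact hm3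
      have e2 : ‖g ξ‖ ≤ B * ‖g ξ‖ ^ θ := by
        rcases (norm_nonneg (g ξ)).eq_or_lt with h | h
        · rw [← h, Real.zero_rpow hθ0.ne', mul_zero]
        · calc ‖g ξ‖ = ‖g ξ‖ ^ (1 - θ) * ‖g ξ‖ ^ θ := by
                rw [← Real.rpow_add h]; simp
            _ ≤ B ^ (1 - θ) * ‖g ξ‖ ^ θ := by gcongr; exact hg ξ
            _ ≤ B * ‖g ξ‖ ^ θ := by
                gcongr
                exact Real.rpow_le_self_of_one_le hB (by linarith)
      calc max 1 |ξ| ^ (m + 2) * ‖g ξ‖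
          ≤ (max 1 |ξ| ^ (b * j)) ^ θ * (B * ‖g ξ‖ ^ θ) := by gcongr
        _ = B * (max 1 |ξ| ^ (b * j) * ‖g ξ‖) ^ θ := by
            rw [Real.mul_rpow (Real.rpow_nonneg (hw0 ξ).le _) (norm_nonneg _)]; ring
        _ ≤ B * M ^ θ := by
            have := hM ξ
            rw [hwb] at this
            gcongr
    have step2 := hgf m _ step1
    have step3 : ∀ x : ℝ, max 1 |x| ^ (j + 2) * ‖f x‖ ≤ K ^ (m + 1) * (B * M ^ θ) := by
      intro x
      refine le_trans ?_ (step2 x)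
      gcongr
      rw [← Real.rpow_natCast, ← Real.rpow_natCast, ← Real.rpow_mul (hw0 x).le]
      apply Real.rpow_le_rpow_of_exponent_le (hw1 x)
      push_cast
      rwa [div_le_iff₀' ha] at hm1
    have step4 : M ≤ K ^ (j + 1) * (K ^ (m + 1) * (B * M ^ θ)) := ciSup_le (hfg j _ step3)
    have hKp : K ^ (j + 1) * K ^ (m + 1) ≤ K ^ ((1 + b) * j) := by
      rw [← pow_add, ← Real.rpow_natCast]
      apply Real.rpow_le_rpow_of_exponent_le hK
      push_cast
      linarith
    -- M is finite by Schwartz decay, so M^θ can be divided out of the self-referential bound.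
    have step5 : M ^ (1 - θ) ≤ B * K ^ ((1 + b) * j) := by
      rw [Real.rpow_sub hM0, Real.rpow_one, div_le_iff₀ (Real.rpow_pos_of_pos hM0 _)]
      calc M ≤ (K ^ (j + 1) * K ^ (m + 1)) * (B * M ^ θ) := by linarith
        _ ≤ K ^ ((1 + b) * j) * (B * M ^ θ) := by gcongr
        _ = _ := by ring
    calc M = (M ^ (1 - θ)) ^ (1 - θ)⁻¹ := by
          rw [← Real.rpow_mul hM0.le, mul_inv_cancel₀ hθ1'.ne', Real.rpow_one]
      _ ≤ (B * K ^ ((1 + b) * j)) ^ (1 - θ)⁻¹ := by gcongr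
      _ = B' * Q ^ j := by
          have hK0 : 0 ≤ K := by linarith
          rw [Real.mul_rpow (by linarith) (Real.rpow_nonneg hK0 _), hB', hQ,
            ← Real.rpow_natCast (K ^ _), ← Real.rpow_mul hK0, ← Real.rpow_mul hK0]
          congr 2
          ring
  refine ⟨Q ^ b⁻¹, Real.one_le_rpow hQ1 (by positivity), fun x hx => ?_⟩
  have hx1 : 1 ≤ |x| := (Real.one_le_rpow hQ1 (by positivity)).trans hx.le
  have hQx : Q < |x| ^ b := by
    have := Real.rpow_lt_rpow (by positivity) hx hb
    rwa [← Real.rpow_mul (by linarith), inv_mul_cancel₀ hb.ne', Real.rpow_one] at this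
  have hxb : 0 < |x| ^ b := by linarith
  have hlim : Filter.Tendsto (fun j : ℕ => B' * (Q / |x| ^ b) ^ j) Filter.atTop (nhds (B' * 0)) :=
    (tendsto_pow_atTop_nhds_zero_of_lt_one (by positivity) ((div_lt_one hxb).2 hQx)).const_mul _
  rw [mul_zero] at hlim
  have : ‖g x‖ ≤ 0 := by
    refine ge_of_tendsto hlim (Filter.eventually_atTop.2 ⟨j₀, fun j hj => ?_⟩)
    have := main j hj x
    rw [max_eq_right hx1] at this
    rw [div_pow, ← mul_div_assoc, le_div_iff₀ (by positivity)]
    linarith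
  exact norm_le_zero_iff.1 this

/-! ### Bounded support on both sides. -/

-- Since g has bounded support, the derivatives of f grow geometrically. Interpolating f at j points
-- where it vanishes, beyond R, leaves c^j/j!, which tends to 0.
open scoped ContDiff in
lemma eq_zero_of_bounded_supports {f g : ℝ → ℂ} {B L R : ℝ} (hf : ContDiff ℝ ∞ f)
    (hfg : DerivControl f g) (hg : ∀ x, ‖g x‖ ≤ B) (hL : 1 ≤ L) (hgL : ∀ x, L < |x| → g x = 0)
    (hR : 1 ≤ R) (hfR : ∀ x, R < |x| → f x = 0) (x : ℝ) : f x = 0 := by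
  have hB : 0 ≤ B := (norm_nonneg _).trans (hg 0)
  have hder : ∀ (j : ℕ) (y : ℝ), ‖iteratedDeriv j f y‖ ≤ (2 * Real.pi) ^ (j + 1) *
      (L ^ (j + 2) * B) := fun j => hfg j _ fun ξ => by
    rcases lt_or_ge L |ξ| with h | h
    · rw [hgL ξ h, norm_zero, mul_zero]
      positivity
    · gcongr
      · exact max_le hL h
      · exact hg ξ
  set D : ℝ := |x| + (R + 2) with hD
  have hbound : ∀ j : ℕ, ‖f x‖ ≤
      4 * Real.pi * L ^ 2 * B * ((2 * Real.pi * L * D) ^ j / j.factorial) := by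
    intro j
    set S : Finset ℝ := (Finset.range j).image fun i : ℕ => R + 1 + (i : ℝ) / (j + 1) with hS
    have hinj : Function.Injective fun i : ℕ => R + 1 + (i : ℝ) / (j + 1) := by
      intro i k h
      have hj : (j : ℝ) + 1 ≠ 0 := by positivity
      have : (i : ℝ) = k := by simpa [div_left_inj' hj] using h
      exact_mod_cast this
    have hcard : S.card = j := by rw [hS, Finset.card_image_of_injective _ hinj, Finset.card_range]
    have hSmem : ∀ s ∈ S, R + 1 ≤ s ∧ s ≤ R + 2 := by
      intro s hs
      obtain ⟨i, hi, rfl⟩ := Finset.mem_image.1 hs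
      have hij : (i : ℝ) < j := by exact_mod_cast Finset.mem_range.1 hi
      have h1 : (i : ℝ) / (j + 1) ≤ 1 := by rw [div_le_one (by positivity)]; linarith
      have h2 : 0 ≤ (i : ℝ) / (j + 1) := by positivity
      constructor <;> linarith
    have h := norm_le_of_zeros S (hf.of_le (by exact_mod_cast le_top))
      (fun s hs => hfR s (by have := (hSmem s hs).1; have := le_abs_self s; linarith))
      (hder S.card) x
    have hprod : ∏ s ∈ S, |x - s| ≤ D ^ j := by
      calc ∏ s ∈ S, |x - s| ≤ ∏ _s ∈ S, D :=
            Finset.prod_le_prod (fun _ _ => abs_nonneg _) fun s hs => by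
              have := hSmem s hs
              refine (abs_sub x s).trans ?_
              rw [abs_of_nonneg (a := s) (by linarith)]
              linarith
        _ = D ^ j := by rw [Finset.prod_const, hcard]
    rw [hcard] at h
    calc ‖f x‖ ≤ 2 * ((2 * Real.pi) ^ (j + 1) * (L ^ (j + 2) * B) / j.factorial * D ^ j) :=
          h.trans (by gcongr)
      _ = _ := by simp only [mul_pow]; ring
  have hlim := (FloorSemiring.tendsto_pow_div_factorial_atTop (2 * Real.pi * L * D)).const_mul
    (4 * Real.pi * L ^ 2 * B)
  rw [mul_zero] at hlim
  exact norm_le_zero_iff.1 (ge_of_tendsto' hlim hbound)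

lemma SchwartzMap.exists_weighted_bound (f : 𝓢(ℝ, ℂ)) (n : ℕ) :
    ∃ M, ∀ x, max 1 |x| ^ n * ‖f x‖ ≤ M := by
  obtain ⟨C, hC⟩ := f.decay 0 0
  obtain ⟨D, hD⟩ := f.decay n 0
  refine ⟨max C D, fun x => ?_⟩
  rcases le_total 1 |x| with h | h
  · rw [max_eq_right h]
    exact (by simpa using hD.2 x : |x| ^ n * ‖f x‖ ≤ D).trans (le_max_right _ _)
  · rw [max_eq_left h]
    exact (by simpa using hC.2 x : (1 : ℝ) ^ n * ‖f x‖ ≤ C).trans (le_max_left _ _)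

/-- Uniqueness for functions whose zeros, and those of whose Fourier transform, have spacing
`O(|x| ^ (-a))` and `O(|x| ^ (-b))` with `a * b > 1`. -/
theorem eq_zero_of_denseZeros {f g : 𝓢(ℝ, ℂ)} {a b C D : ℝ} (ha : 0 < a) (hb : 0 < b)
    (hab : 1 < a * b) (hC : 0 ≤ C) (hD : 0 ≤ D) (hfg : DerivControl f g) (hgf : DerivControl g f)
    (hzf : DenseZeros f a C) (hzg : DenseZeros g b D) : f = 0 := by
  obtain ⟨K₁, hK₁, h₁⟩ := weighted_bound_of_denseZeros f.smooth' hC hfg hzf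
  obtain ⟨K₂, hK₂, h₂⟩ := weighted_bound_of_denseZeros g.smooth' hD hgf hzg
  have bdd : ∀ h : 𝓢(ℝ, ℂ), ∃ B : ℝ, 1 ≤ B ∧ ∀ x, ‖h x‖ ≤ B := fun h => by
    obtain ⟨M, hM⟩ := h.exists_weighted_bound 0
    exact ⟨max 1 M, le_max_left _ _, fun x => (by simpa using hM x : ‖h x‖ ≤ M).trans
      (le_max_right _ _)⟩
  have mono : ∀ {K K' : ℝ}, 1 ≤ K → K ≤ K' → ∀ {u v : ℝ → ℂ} {c : ℝ},
      (∀ (j : ℕ) (M : ℝ), (∀ ξ : ℝ, max 1 |ξ| ^ (j + 2) * ‖v ξ‖ ≤ M) →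
        ∀ x : ℝ, (max 1 |x| ^ c) ^ j * ‖u x‖ ≤ K ^ (j + 1) * M) →
      (∀ (j : ℕ) (M : ℝ), (∀ ξ : ℝ, max 1 |ξ| ^ (j + 2) * ‖v ξ‖ ≤ M) →
        ∀ x : ℝ, (max 1 |x| ^ c) ^ j * ‖u x‖ ≤ K' ^ (j + 1) * M) := by
    intro K K' hK hKK u v c h j M hM x
    have hM0 : 0 ≤ M := le_trans (by positivity) (hM 0)
    exact (h j M hM x).trans (by gcongr)
  obtain ⟨Bf, hBf, hf⟩ := bdd f
  obtain ⟨Bg, hBg, hg⟩ := bdd g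
  have hK : 1 ≤ max K₁ K₂ := hK₁.trans (le_max_left _ _)
  have h₁' := mono hK₁ (le_max_left K₁ K₂) h₁
  have h₂' := mono hK₂ (le_max_right K₁ K₂) h₂
  obtain ⟨L, hL, hgL⟩ := exists_forall_eq_zero_of_weighted_bounds ha hb hab hK hBg hg
    g.exists_weighted_bound h₁' h₂'
  obtain ⟨R, hR, hfR⟩ := exists_forall_eq_zero_of_weighted_bounds hb ha (by rwa [mul_comm]) hK hBf
    hf f.exists_weighted_bound h₂' h₁'
  ext x
  exact eq_zero_of_bounded_supports f.smooth' hfg hg hL hgL hR hfR x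
-- Spacing of powers and logarithms.
lemma denseZeros_of_symmetric {f : ℝ → ℂ} {a C : ℝ}
    (h : ∀ y : ℝ, 1 ≤ y → ∀ j : ℕ, ∃ S : Finset ℝ, S.card = j ∧
      ∀ s ∈ S, (f s = 0 ∧ f (-s) = 0) ∧ |y - s| ≤ C * j / y ^ a) : DenseZeros f a C := by
  intro x hx j
  obtain ⟨S, hS, hs⟩ := h |x| hx j
  rcases abs_cases x with ⟨hx', -⟩ | ⟨hx', -⟩
  · exact ⟨S, hS, fun s h => ⟨(hs s h).1.1, by simpa [hx'] using (hs s h).2⟩⟩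
  · refine ⟨S.image Neg.neg, by rw [Finset.card_image_of_injective _ neg_injective, hS], ?_⟩
    intro t ht
    obtain ⟨s, h, rfl⟩ := Finset.mem_image.1 ht
    refine ⟨(hs s h).1.2, ?_⟩
    have := (hs s h).2
    rw [hx', abs_sub_comm] at this
    rwa [hx', show x - -s = s - -x by ring]

/-- A strictly increasing function on the positive reals that exceeds `y` at `X` gives
`j` values at integers lying within `φ (X + j) - y` of `y`. -/
lemma exists_finset_image_near {φ : ℝ → ℝ} (hφ : StrictMonoOn φ (Set.Ioi 0)) {X : ℝ} (hX : 0 < X)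
    (j : ℕ) : ∃ S : Finset ℝ, S.card = j ∧
      ∀ s ∈ S, (∃ n : ℕ, s = φ ((n : ℝ) + 1)) ∧ |φ X - s| ≤ φ (X + j) - φ X := by
  -- The integers m + 1, …, m + j all lie in (X, X + j].
  set m : ℕ := ⌊X⌋₊
  have hm1 : (m : ℝ) ≤ X := Nat.floor_le hX.le
  have hm2 : X < m + 1 := Nat.lt_floor_add_one X
  have hpos : ∀ n : ℕ, (n : ℝ) + 1 ∈ Set.Ioi (0 : ℝ) := fun n => by
    simp only [Set.mem_Ioi]; positivity
  have hinj : Function.Injective fun i : ℕ => φ (((m + i : ℕ) : ℝ) + 1) := by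
    intro i k h
    have := hφ.injOn (hpos _) (hpos _) h
    have h' : m + i = m + k := by exact_mod_cast add_right_cancel this
    omega
  refine ⟨(Finset.range j).image fun i : ℕ => φ (((m + i : ℕ) : ℝ) + 1),
    by rw [Finset.card_image_of_injective _ hinj, Finset.card_range], fun s hs => ?_⟩
  obtain ⟨i, hi, rfl⟩ := Finset.mem_image.1 hs
  refine ⟨⟨m + i, rfl⟩, ?_⟩
  have hij : (i : ℝ) + 1 ≤ j := by exact_mod_cast Finset.mem_range.1 hi
  have h1 : φ X ≤ φ (((m + i : ℕ) : ℝ) + 1) := hφ.monotoneOn hX (hpos _) (by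
    push_cast
    have : (0 : ℝ) ≤ i := by positivity
    linarith)
  have h2 : φ (((m + i : ℕ) : ℝ) + 1) ≤ φ (X + j) :=
    hφ.monotoneOn (hpos _) (by simp only [Set.mem_Ioi]; positivity) (by push_cast; linarith)
  rw [abs_sub_comm, abs_of_nonneg (by linarith)]
  linarith

lemma denseZeros_of_rpow {f : ℝ → ℂ} {α : ℝ} (hα0 : 0 < α) (hα1 : α < 1)
    (h : ∀ n : ℕ, f ((n : ℝ) ^ α) = 0 ∧ f (-((n : ℝ) ^ α)) = 0) :
    DenseZeros f (1 / α - 1) 1 := by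
  refine denseZeros_of_symmetric fun y hy j => ?_
  have hy0 : 0 < y := by linarith
  set X : ℝ := y ^ (1 / α) with hX
  have hX0 : 0 < X := Real.rpow_pos_of_pos hy0 _
  have hXα : X ^ α = y := by
    rw [hX, ← Real.rpow_mul hy0.le, one_div, inv_mul_cancel₀ hα0.ne', Real.rpow_one]
  obtain ⟨S, hS, hs⟩ := exists_finset_image_near (φ := fun t => t ^ α)
    (fun u hu v _ huv => Real.rpow_lt_rpow (le_of_lt hu) huv hα0) hX0 j
  refine ⟨S, hS, fun s hsS => ?_⟩
  obtain ⟨⟨n, rfl⟩, hle⟩ := hs s hsS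
  refine ⟨by simpa using h (n + 1), ?_⟩
  simp only [hXα] at hle
  refine hle.trans ?_
  have hbern : (1 + j / X) ^ α ≤ 1 + α * (j / X) :=
    rpow_one_add_le_one_add_mul_self (by
      have : 0 ≤ j / X := by positivity
      linarith) hα0.le hα1.le
  have hsplit : (X + j) ^ α = y * (1 + j / X) ^ α := by
    rw [← hXα, ← Real.mul_rpow hX0.le (by positivity)]
    congr 1
    field_simp
  have hya : y ^ (1 / α - 1) = X / y := by rw [Real.rpow_sub hy0, Real.rpow_one]
  rw [hsplit, hya, one_mul]
  have hj : α * (j / X) ≤ j / X := mul_le_of_le_one_left (by positivity) hα1.le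
  calc y * (1 + j / X) ^ α - y ≤ y * (1 + j / X) - y := by gcongr; linarith
    _ = j / (X / y) := by field_simp; ring

/-- Near y the spacing is about e^(-y), smaller than a constant times y^(-a) for any a. -/
lemma exists_denseZeros_of_log {f : ℝ → ℂ} (a : ℝ)
    (h : ∀ n : ℕ, f (Real.log ((n : ℝ) + 1)) = 0 ∧ f (-Real.log ((n : ℝ) + 1)) = 0) :
    ∃ C : ℝ, 0 ≤ C ∧ DenseZeros f a C := by
  refine ⟨(⌈a⌉₊.factorial : ℝ), by positivity, denseZeros_of_symmetric fun y hy j => ?_⟩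
  have hy0 : 0 < y := by linarith
  have hE : 0 < Real.exp y := Real.exp_pos y
  obtain ⟨S, hS, hs⟩ := exists_finset_image_near Real.strictMonoOn_log hE j
  refine ⟨S, hS, fun s hsS => ?_⟩
  obtain ⟨⟨n, rfl⟩, hle⟩ := hs s hsS
  refine ⟨h n, ?_⟩
  rw [Real.log_exp] at hle
  refine hle.trans ?_
  have hsplit : Real.exp y + j = Real.exp y * (1 + j / Real.exp y) := by field_simp
  have h1 : Real.log (Real.exp y + j) - y ≤ j / Real.exp y := by
    rw [hsplit, Real.log_mul hE.ne' (by positivity), Real.log_exp]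
    have := Real.log_le_sub_one_of_pos (x := 1 + j / Real.exp y) (by positivity)
    linarith
  refine h1.trans ?_
  have h2 : y ^ a ≤ ⌈a⌉₊.factorial * Real.exp y := by
    have h3 : y ^ a ≤ y ^ ⌈a⌉₊ := by
      rw [← Real.rpow_natCast]
      exact Real.rpow_le_rpow_of_exponent_le hy (Nat.le_ceil a)
    have h4 := Real.pow_div_factorial_le_exp y hy0.le ⌈a⌉₊
    rw [div_le_iff₀ (by positivity)] at h4
    linarith
  have hya : 0 < y ^ a := Real.rpow_pos_of_pos hy0 _
  rw [div_le_div_iff₀ hE hya]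
  calc (j : ℝ) * y ^ a ≤ j * (⌈a⌉₊.factorial * Real.exp y) := by gcongr
    _ = _ := by ring

/-! ### The two uniqueness statements. -/

open scoped FourierTransform in
lemma eq_zero_of_denseZeros_fourierHat {f : 𝓢(ℝ, ℂ)} {a b C D : ℝ} (ha : 0 < a) (hb : 0 < b)
    (hab : 1 < a * b) (hC : 0 ≤ C) (hD : 0 ≤ D) (hzf : DenseZeros f a C)
    (hzg : DenseZeros (fourierHat f) b D) : f = 0 := by
  have hhat : fourierHat f = (𝓕⁻ f : 𝓢(ℝ, ℂ)) := funext (fourierHat_eq_fourierInv f)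
  rw [hhat] at hzg
  have hfg : DerivControl f (𝓕⁻ f : 𝓢(ℝ, ℂ)) := by
    simpa using derivControl_fourier (𝓕⁻ f)
  exact eq_zero_of_denseZeros ha hb hab hC hD hfg (derivControl_fourierInv f) hzf hzg

theorem theorem1 (α β : ℝ) (hα0 : 0 < α) (hα1 : α < 1) (hβ0 : 0 < β) (hβ1 : β < 1)
    (f : 𝓢(ℝ, ℂ)) :
    ((∀ n : ℕ, f (Real.log ((n : ℝ) + 1)) = 0 ∧ f (-Real.log ((n : ℝ) + 1)) = 0) →
      (∀ n : ℕ, fourierHat f ((n : ℝ) ^ α) = 0 ∧ fourierHat f (-((n : ℝ) ^ α)) = 0) →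
      f = 0) ∧
    ((α, β) ∈ admissibleRegion →
      (∀ n : ℕ, f ((n : ℝ) ^ α) = 0 ∧ f (-((n : ℝ) ^ α)) = 0) →
      (∀ n : ℕ, fourierHat f ((n : ℝ) ^ β) = 0 ∧ fourierHat f (-((n : ℝ) ^ β)) = 0) →
      f = 0) := by
  have gap_pos : ∀ {γ : ℝ}, 0 < γ → γ < 1 → 0 < 1 / γ - 1 := fun h0 h1 => by
    rw [sub_pos, lt_div_iff₀ h0]; linarith
  have ha := gap_pos hα0 hα1
  have hb := gap_pos hβ0 hβ1
  refine ⟨fun hf hg => ?_, fun hA hf hg => ?_⟩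
  -- The exponent for the logarithms is free; this choice makes the product of the two exponents 2.
  · obtain ⟨C, hC, hz⟩ := exists_denseZeros_of_log (2 / (1 / α - 1)) hf
    refine eq_zero_of_denseZeros_fourierHat (by positivity) ha ?_ hC zero_le_one hz
      (denseZeros_of_rpow hα0 hα1 hg)
    rw [div_mul_cancel₀ _ ha.ne']
    norm_num
  · have hsum : α + β < 1 := hA.2.2.1
    refine eq_zero_of_denseZeros_fourierHat ha hb ?_ zero_le_one zero_le_one
      (denseZeros_of_rpow hα0 hα1 hf) (denseZeros_of_rpow hβ0 hβ1 hg)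
    have : (1 / α - 1) * (1 / β - 1) = 1 + (1 - α - β) / (α * β) := by
      field_simp
      ring
    rw [this]
    have : 0 < (1 - α - β) / (α * β) := div_pos (by linarith) (by positivity)
    linarith
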